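/- Let $M$ be a smooth $m$-dimensional manifold (Hausdorff, second countable, without boundary) with a Poisson tensor $\Pi$, let $\Pi^\sharp\colon T^*M\to TM$ be the bundle map $\beta(\Pi^\sharp\alpha)=\Pi(\alpha,\beta)$, and let $\{f,g\}=\Pi(df,dg)$ be the Poisson bracket on $\mathcal A=C^\infty(M)$. Let $N\subset M$ be a closed embedded submanifold, with conormal spaces $T_pN^0=\{\alpha\in T_p^*M : \alpha|_{T_pN}=0\}$, and put $$\mathcal I=\{f\in\mathcal A : f|_N=0\},\qquad \mathcal F=\{f\in\mathcal A : \{f,\mathcal I\}\subset\mathcal I\},\qquad \mathcal A_{\rm inv}=\{f\in\mathcal A : \{f,\mathcal F\cap\mathcal I\}\subset\mathcal I\}.$$ Let $\phi\colon\mathcal F/(\mathcal F\cap\mathcal I)\to\mathcal A/\mathcal I$ be the algebra homomorphism $f+\mathcal F\cap\mathcal I\mapsto f+\mathcal I$. Consider the conditions (a) $\dim\big(\Pi^\sharp_p(T_pN^0)+T_pN\big)$ is the same for all $p\in N$; (b) $(\Pi^\sharp_p)^{-1}(T_pN)\cap T_pN^0=\{(dg)_p : g\in\mathcal F\cap\mathcal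 I\}$ for all $p\in N$. Then (a) implies (b), and if $N$ is connected, (b) implies (a). Moreover, if (a) holds, then $$\phi\big(\mathcal F/(\mathcal F\cap\mathcal I)\big)=\mathcal A_{\rm inv}/\mathcal I .$$ -/

import Mathlib

open Bundle Manifold
open scoped Manifold ContDiff

noncomputable section

namespace PoissonReduction

section Poisson

variable {m : ℕ} {M : Type*} [TopologicalSpace M] [ChartedSpace (EuclideanSpace ℝ (Fin m)) M]

/-- The cotangent space `T*_x M`. -/
abbrev Cotangent (m : ℕ) {M : Type*} [TopologicalSpace M]
    [ChartedSpace (EuclideanSpace ℝ (Fin m)) M] (x : M) : Type :=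
  TangentSpace (𝓡 m) x →L[ℝ] ℝ

/-- The algebra `𝒜 = C^∞(M)` of smooth real functions on an `m`-dimensional manifold `M`. -/
abbrev Smooth (m : ℕ) (M : Type*) [TopologicalSpace M]
    [ChartedSpace (EuclideanSpace ℝ (Fin m)) M] : Type _ :=
  C^∞⟮𝓡 m, M; ℝ⟯

/-- The differential `(df)_x ∈ T*_x M`. -/
def diff (f : Smooth m M) (x : M) : Cotangent m x :=
  mvfderiv (𝓡 m) f x

theorem diff_add (f g : Smooth m M) (x : M) : diff (f + g) x = diff f x + diff g x :=
  mvfderiv_add ((f.contMDiff x).mdifferentiableAt (by simp))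
    ((g.contMDiff x).mdifferentiableAt (by simp))

theorem diff_mul (f g : Smooth m M) (x : M) :
    diff (f * g) x = f x • diff g x + g x • diff f x :=
  mvfderiv_mul ((f.contMDiff x).mdifferentiableAt (by simp))
    ((g.contMDiff x).mdifferentiableAt (by simp))

theorem diff_algebraMap (c : ℝ) (x : M) : diff (algebraMap ℝ (Smooth m M) c) x = 0 :=
  mvfderiv_const c

variable [IsManifold (𝓡 m) ∞ M]

theorem contMDiff_diff (f : Smooth m M) :
    ContMDiff (𝓡 m) ((𝓡 m).prod 𝓘(ℝ, EuclideanSpace ℝ (Fin m) →L[ℝ] ℝ)) ∞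
      (fun x : M ↦ TotalSpace.mk' (EuclideanSpace ℝ (Fin m) →L[ℝ] ℝ)
        (E := fun x : M ↦ TangentSpace (𝓡 m) x →L[ℝ] Bundle.Trivial M ℝ x) x (diff f x)) := by
  intro x
  rw [contMDiffAt_hom_bundle]
  refine ⟨contMDiffAt_id, ?_⟩
  have h := (f.contMDiff x).mfderiv_const (m := ∞) (by simp)
  convert h using 2
  ext v
  simp [inTangentCoordinates, ContinuousLinearMap.inCoordinates, diff, mvfderiv]
  rfl

variable (m M) in
/-- A smooth bivector field `Π` on `M`, given by the smooth bundle map `Π♯ : T*M → TM` with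
`β (Π♯ α) = Π(α, β)`; the skew-symmetry of `Π` is `β (Π♯ α) = - α (Π♯ β)`. -/
structure BivectorField where
  /-- the map `Π♯_x : T*_x M → T_x M` -/
  sharp (x : M) : Cotangent m x →L[ℝ] TangentSpace (𝓡 m) x
  skew (x : M) (α β : Cotangent m x) : β (sharp x α) = - α (sharp x β)
  /-- `Π♯` is a smooth section of the vector bundle `Hom(T*M, TM)` -/
  contMDiff_sharp :
    ContMDiff (𝓡 m)
      ((𝓡 m).prod 𝓘(ℝ, (EuclideanSpace ℝ (Fin m) →L[ℝ] ℝ) →L[ℝ] EuclideanSpace ℝ (Fin m))) ∞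
      (fun x : M ↦ TotalSpace.mk'
        ((EuclideanSpace ℝ (Fin m) →L[ℝ] ℝ) →L[ℝ] EuclideanSpace ℝ (Fin m))
        (E := fun x : M ↦ (TangentSpace (𝓡 m) x →L[ℝ] Bundle.Trivial M ℝ x) →L[ℝ]
          TangentSpace (𝓡 m) x) x (sharp x))

/-- The bracket `{f, g} = Π(df, dg) = dg (Π♯ df)` of two smooth functions. -/
def BivectorField.bracket (P : BivectorField m M) (f g : Smooth m M) : Smooth m M :=
  ⟨fun x ↦ diff g x (P.sharp x (diff f x)), fun x ↦
    (contMDiffAt_totalSpace.mp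
      (ContMDiff.clm_bundle_apply (contMDiff_diff g)
        (ContMDiff.clm_bundle_apply P.contMDiff_sharp (contMDiff_diff f)) x)).2⟩

theorem BivectorField.bracket_apply (P : BivectorField m M) (f g : Smooth m M) (x : M) :
    P.bracket f g x = diff g x (P.sharp x (diff f x)) := rfl

variable (m M) in
/-- A Poisson structure (Poisson tensor) on `M`: a smooth bivector field whose bracket on
`C^∞(M)` satisfies the Jacobi identity. -/
structure PoissonStructure extends BivectorField m M where
  jacobi (f g h : Smooth m M) :
    toBivectorField.bracket f (toBivectorField.bracket g h) +
      toBivectorField.bracket g (toBivectorField.bracket h f) +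
      toBivectorField.bracket h (toBivectorField.bracket f g) = 0

end Poisson

section Reduction

variable {m : ℕ} {M : Type*} [TopologicalSpace M] [ChartedSpace (EuclideanSpace ℝ (Fin m)) M]
  [IsManifold (𝓡 m) ∞ M] {N : Type*}

/-- The ideal `ℐ ⊆ 𝒜` of the functions that vanish on the submanifold `N`, with `ι` the inclusion
of `N` into `M`. -/
def vanishingIdeal (m : ℕ) {M : Type*} [TopologicalSpace M]
    [ChartedSpace (EuclideanSpace ℝ (Fin m)) M] {N : Type*} (ι : N → M) : Ideal (Smooth m M) where
  carrier := {f | ∀ p, f (ι p) = 0}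
  zero_mem' _ := rfl
  add_mem' {f g} hf hg p := by simp [hf p, hg p]
  smul_mem' c f hf p := by simp [hf p]

/-- The subalgebra `{f ∈ 𝒜 | {f, S} ⊆ ℐ}` for a set `S` of smooth functions. -/
def normalizer (P : PoissonStructure m M) (ι : N → M) (S : Set (Smooth m M)) :
    Subalgebra ℝ (Smooth m M) where
  carrier := {f | ∀ g ∈ S, P.bracket f g ∈ vanishingIdeal m ι}
  mul_mem' {f g} hf hg h hh p := by
    have h1 := hf h hh p
    have h2 := hg h hh p
    simp only [BivectorField.bracket_apply] at h1 h2 ⊢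
    simp [diff_mul, h1, h2]
  add_mem' {f g} hf hg h hh p := by
    have h1 := hf h hh p
    have h2 := hg h hh p
    simp only [BivectorField.bracket_apply] at h1 h2 ⊢
    simp [diff_add, h1, h2]
  algebraMap_mem' c h _ p := by
    simp [BivectorField.bracket_apply, diff_algebraMap]

/-- The algebra `ℱ = {f ∈ 𝒜 | {f, ℐ} ⊆ ℐ}` of first-class functions. -/
def firstClass (P : PoissonStructure m M) (ι : N → M) : Subalgebra ℝ (Smooth m M) :=
  normalizer P ι {g | g ∈ vanishingIdeal m ι}

/-- The first-class constraints `ℱ ∩ ℐ`. -/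
def firstClassConstraints (P : PoissonStructure m M) (ι : N → M) : Set (Smooth m M) :=
  {g | g ∈ firstClass P ι ∧ g ∈ vanishingIdeal m ι}

/-- The algebra `𝒜_inv = {f ∈ 𝒜 | {f, ℱ ∩ ℐ} ⊆ ℐ}` of gauge invariant functions. -/
def gaugeInvariant (P : PoissonStructure m M) (ι : N → M) : Subalgebra ℝ (Smooth m M) :=
  normalizer P ι (firstClassConstraints P ι)

/-- `ℱ ∩ ℐ` as an ideal of the algebra `ℱ`. -/
def constraintIdeal (P : PoissonStructure m M) (ι : N → M) : Ideal (firstClass P ι) :=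
  (vanishingIdeal m ι).comap (firstClass P ι).val

/-- The homomorphism `φ : ℱ / (ℱ ∩ ℐ) → 𝒜 / ℐ`, `f + ℱ ∩ ℐ ↦ f + ℐ`. -/
def phi (P : PoissonStructure m M) (ι : N → M) :
    (firstClass P ι ⧸ constraintIdeal P ι) →ₐ[ℝ] (Smooth m M ⧸ vanishingIdeal m ι) :=
  Ideal.quotientMapₐ (vanishingIdeal m ι) (firstClass P ι).val le_rfl

/-- `𝒜_inv / ℐ`, as a subalgebra of `𝒜 / ℐ`. -/
def gaugeInvariantQuotient (P : PoissonStructure m M) (ι : N → M) :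
    Subalgebra ℝ (Smooth m M ⧸ vanishingIdeal m ι) :=
  (gaugeInvariant P ι).map (Ideal.Quotient.mkₐ ℝ (vanishingIdeal m ι))

/-- The tangent space `T_p N`, as a subspace of `T_p M`. -/
def tangentN (m n : ℕ) {M : Type*} [TopologicalSpace M]
    [ChartedSpace (EuclideanSpace ℝ (Fin m)) M] {N : Type*} [TopologicalSpace N]
    [ChartedSpace (EuclideanSpace ℝ (Fin n)) N] (ι : N → M) (p : N) :
    Submodule ℝ (TangentSpace (𝓡 m) (ι p)) :=
  (mfderiv (𝓡 n) (𝓡 m) ι p).range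

/-- The conormal space `T_p N⁰ ⊆ T*_p M`, the covectors that kill `T_p N`. -/
def conormal (m n : ℕ) {M : Type*} [TopologicalSpace M]
    [ChartedSpace (EuclideanSpace ℝ (Fin m)) M] {N : Type*} [TopologicalSpace N]
    [ChartedSpace (EuclideanSpace ℝ (Fin n)) N] (ι : N → M) (p : N) :
    Submodule ℝ (Cotangent m (ι p)) where
  carrier := {α | ∀ v ∈ tangentN m n ι p, α v = 0}
  zero_mem' _ _ := rfl
  add_mem' {α β} hα hβ v hv := by simp [hα v hv, hβ v hv]
  smul_mem' c α hα v hv := by simp [hα v hv]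

/-- The condition `dim (Π♯_p (T_p N⁰) + T_p N) = const` for all `p ∈ N`. -/
def ConstantRank (n : ℕ) {N : Type*} [TopologicalSpace N]
    [ChartedSpace (EuclideanSpace ℝ (Fin n)) N] (P : PoissonStructure m M) (ι : N → M) : Prop :=
  ∃ d : ℕ, ∀ p : N, Module.finrank ℝ
    ↥((conormal m n ι p).map (P.sharp (ι p)).toLinearMap ⊔ tangentN m n ι p) = d

/-- The condition `Π♯_p⁻¹(T_p N) ∩ T_p N⁰ = {(dg)_p | g ∈ ℱ ∩ ℐ}` for all `p ∈ N`. -/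
def SpannedByConstraints (n : ℕ) {N : Type*} [TopologicalSpace N]
    [ChartedSpace (EuclideanSpace ℝ (Fin n)) N] (P : PoissonStructure m M) (ι : N → M) : Prop :=
  ∀ p : N, (((tangentN m n ι p).comap (P.sharp (ι p)).toLinearMap ⊓ conormal m n ι p :
      Submodule ℝ (Cotangent m (ι p))) : Set (Cotangent m (ι p))) =
    {α | ∃ g ∈ firstClassConstraints P ι, diff g (ι p) = α}

end Reduction

end PoissonReduction

end

/-! Let R_p be the radical of Π on the conormal space, the left side of (b). By skew-symmetry R_p is
the annihilator of Π♯(T_pN⁰) + T_pN, so (a) says that dim R_p is constant. In a local conormal frame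
dy_i with y_i ∈ ℐ, R_p is the kernel of the matrix of brackets {y_j, y_i}
(`finrank_ker_bracketMatrix`).

(a) ⇒ (b): a smooth linear system with kernels of constant dimension has smooth local solutions
through a prescribed value (`exists_smooth_local_solution`). A solution b gives g = ∑ b_i y_i ∈ ℐ
with dg = ∑ b_i dy_i on N; a bump function makes it global.

(b) ⇒ (a): differentials of constraints lie in R everywhere and stay independent nearby, so dim R
cannot drop locally; as the kernel of a continuous matrix it cannot jump up. It is thus locally
constant.

Image of φ: for gauge invariant f, R_p kills Π♯df, so Π♯df ∈ Π♯(T_pN⁰) + T_pN. The same linear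
system gives local corrections g ∈ ℐ with Π♯d(f + g) tangent to N, and a partition of unity glues
them. -/

noncomputable section

namespace PoissonReduction

open Topology Filter

/-! ### Annihilators and skew maps -/

section LinearAlgebra

variable {V : Type*} [AddCommGroup V] [Module ℝ V] [TopologicalSpace V] [IsTopologicalAddGroup V]
  [ContinuousSMul ℝ V] [T2Space V] [FiniteDimensional ℝ V]

theorem finiteDimensional_continuousDual : FiniteDimensional ℝ (V →L[ℝ] ℝ) :=
  (LinearMap.toContinuousLinearMap : (V →ₗ[ℝ] ℝ) ≃ₗ[ℝ] _).finiteDimensional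

/-- The annihilator of a subspace in the continuous dual. -/
def annihilator (S : Submodule ℝ V) : Submodule ℝ (V →L[ℝ] ℝ) :=
  S.dualAnnihilator.map (LinearMap.toContinuousLinearMap : (V →ₗ[ℝ] ℝ) ≃ₗ[ℝ] _).toLinearMap

theorem mem_annihilator {S : Submodule ℝ V} {α : V →L[ℝ] ℝ} :
    α ∈ annihilator S ↔ ∀ v ∈ S, α v = 0 := by
  simp only [annihilator, Submodule.mem_map, Submodule.mem_dualAnnihilator]
  constructor
  · rintro ⟨φ, h, rfl⟩ v hv
    exact h v hv
  · intro h
    exact ⟨α, h, by ext; rfl⟩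

theorem finrank_add_finrank_annihilator (S : Submodule ℝ V) :
    Module.finrank ℝ S + Module.finrank ℝ (annihilator S) = Module.finrank ℝ V := by
  rw [annihilator, LinearEquiv.finrank_map_eq]
  exact Subspace.finrank_add_finrank_dualAnnihilator_eq S

theorem mem_of_forall_annihilator {S : Submodule ℝ V} {v : V}
    (h : ∀ α ∈ annihilator S, α v = 0) : v ∈ S := by
  rw [← Subspace.forall_mem_dualAnnihilator_apply_eq_zero_iff S v]
  intro φ hφ
  exact h (LinearMap.toContinuousLinearMap φ) ⟨φ, hφ, rfl⟩

/-- By skewness, β kills σ(W⁰) exactly when every α ∈ W⁰ kills σ β, that is, when σ β ∈ W. -/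
theorem annihilator_map_sup (σ : (V →L[ℝ] ℝ) →L[ℝ] V)
    (hσ : ∀ α β : V →L[ℝ] ℝ, β (σ α) = - α (σ β)) (W : Submodule ℝ V) :
    annihilator ((annihilator W).map σ.toLinearMap ⊔ W) =
      W.comap σ.toLinearMap ⊓ annihilator W := by
  ext β
  rw [Submodule.mem_inf, mem_annihilator]
  constructor
  · intro h
    refine ⟨mem_of_forall_annihilator (v := σ β) fun α hα ↦ ?_, mem_annihilator.2 fun v hv ↦
      h v (Submodule.mem_sup_right hv)⟩
    have := h (σ α) (Submodule.mem_sup_left ⟨α, hα, rfl⟩)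
    have h2 := hσ α β
    linarith
  · rintro ⟨h1, h2⟩ v hv
    obtain ⟨u, ⟨α, hα, rfl⟩, w, hw, rfl⟩ := Submodule.mem_sup.1 hv
    have h3 := mem_annihilator.1 hα _ h1
    simp only [ContinuousLinearMap.coe_coe] at h3 ⊢
    rw [map_add, mem_annihilator.1 h2 w hw, hσ α β, h3]
    simp

theorem exists_linearIndependent_fin {W : Type*} [AddCommGroup W] [Module ℝ W]
    [FiniteDimensional ℝ W] (S : Submodule ℝ W) :
    ∃ e : Fin (Module.finrank ℝ S) → W, LinearIndependent ℝ e ∧ ∀ i, e i ∈ S :=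
  ⟨fun i ↦ Module.finBasis ℝ S i,
    (Module.finBasis ℝ S).linearIndependent.map' S.subtype S.ker_subtype, fun _ ↦ Subtype.prop _⟩

theorem span_eq_of_linearIndependent {W : Type*} [AddCommGroup W] [Module ℝ W]
    [FiniteDimensional ℝ W] {S : Submodule ℝ W} {d : ℕ} (hd : Module.finrank ℝ S = d)
    {e : Fin d → W} (he : LinearIndependent ℝ e) (heS : ∀ i, e i ∈ S) :
    Submodule.span ℝ (Set.range e) = S := by
  refine Submodule.eq_of_le_of_finrank_eq
    (Submodule.span_le.2 (Set.range_subset_iff.2 heS)) ?_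
  rw [finrank_span_eq_card he, Fintype.card_fin, hd]

theorem le_finrank_of_linearIndependent {W : Type*} [AddCommGroup W] [Module ℝ W]
    [FiniteDimensional ℝ W] {S : Submodule ℝ W} {d : ℕ}
    {e : Fin d → W} (he : LinearIndependent ℝ e) (heS : ∀ i, e i ∈ S) :
    d ≤ Module.finrank ℝ S := by
  rw [← Fintype.card_fin d, ← finrank_span_eq_card he]
  exact Submodule.finrank_mono (Submodule.span_le.2 (Set.range_subset_iff.2 heS))

end LinearAlgebra

/-! ### Linear systems of constant rank -/

section GeneralizedInverse

variable {E : Type*} [NormedAddCommGroup E] [NormedSpace ℝ E] [FiniteDimensional ℝ E]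

theorem exists_generalizedInverse (A : E →L[ℝ] E) :
    ∃ G : E →L[ℝ] E, (∀ v, A (G (A v)) = A v) ∧ ∀ v, G (A (G v)) = G v := by
  obtain ⟨g, hg⟩ := A.toLinearMap.rangeRestrict.exists_rightInverse_of_surjective
    A.toLinearMap.range_rangeRestrict
  obtain ⟨r, hr⟩ := A.toLinearMap.range.subtype.exists_leftInverse_of_injective
    (Submodule.ker_subtype _)
  have h1 (u) : A (g u) = u := congrArg Subtype.val (LinearMap.congr_fun hg u)
  have h2 (u : A.toLinearMap.range) : r u = u := LinearMap.congr_fun hr u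
  refine ⟨LinearMap.toContinuousLinearMap (g ∘ₗ r), fun v ↦ ?_, fun v ↦ ?_⟩
  · have := h2 ⟨A v, v, rfl⟩
    simp only [LinearMap.coe_toContinuousLinearMap', LinearMap.comp_apply, h1]
    exact congrArg Subtype.val this
  · simp only [LinearMap.coe_toContinuousLinearMap', LinearMap.comp_apply, h1, h2]

/-- On ker(GA) the injective map GA + (1 - GA₀) equals 1 - GA₀, with values in ker A₀. Counting
dimensions, ker(GA) = ker A, so G loses nothing on the range of A. Applying GA₀ to `hb` leaves GAb =
Gc. -/
theorem apply_eq_of_finrank_ker_eq {A₀ G A : E →L[ℝ] E}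
    (h1 : ∀ v, A₀ (G (A₀ v)) = A₀ v) (h2 : ∀ v, G (A₀ (G v)) = G v)
    (hrank : Module.finrank ℝ A.toLinearMap.ker = Module.finrank ℝ A₀.toLinearMap.ker)
    (hT : Function.Injective fun v ↦ G (A v) + (v - G (A₀ v)))
    {b c w : E} (hc : c ∈ A.toLinearMap.range) (hw : A₀ w = 0)
    (hb : G (A b) + (b - G (A₀ b)) = w + G c) : A b = c := by
  have hker : A.toLinearMap.ker = (G.comp A).toLinearMap.ker := by
    refine Submodule.eq_of_le_of_finrank_le (fun v hv ↦ ?_) ?_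
    · have : A v = 0 := hv
      simp [this]
    · rw [hrank]
      let S : (G.comp A).toLinearMap.ker →ₗ[ℝ] A₀.toLinearMap.ker :=
        (LinearMap.id - (G.comp A₀).toLinearMap).restrict (p := (G.comp A).toLinearMap.ker)
          (q := A₀.toLinearMap.ker) fun v _ ↦ by simp [h1]
      refine LinearMap.finrank_le_finrank_of_injective (f := S) fun u v huv ↦ ?_
      have hu : G (A u) = 0 := u.2
      have hv : G (A v) = 0 := v.2
      have : (u : E) - G (A₀ u) = v - G (A₀ v) := congrArg Subtype.val huv
      refine Subtype.ext (hT ?_)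
      simpa only [hu, hv, zero_add] using this
  have h3 : G (A b) = G c := by
    have := congrArg (fun v ↦ G (A₀ v)) hb
    simpa [h1, h2, hw] using this
  obtain ⟨v, rfl⟩ := hc
  have : b - v ∈ (G.comp A).toLinearMap.ker := by
    simp only [ContinuousLinearMap.coe_coe] at h3
    simp [h3]
  rw [← hker] at this
  exact sub_eq_zero.1 ((map_sub A b v).symm.trans this)

variable {H : Type*} [TopologicalSpace H] {F : Type*} [NormedAddCommGroup F] [NormedSpace ℝ F]
  {I : ModelWithCorners ℝ F H} {X : Type*} [TopologicalSpace X] [ChartedSpace H X]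

/-- A linear system with smooth coefficients and kernels of constant dimension has
smooth local solutions with a prescribed value at a point. -/
theorem exists_smooth_local_solution {A : X → E →L[ℝ] E} (hA : ContMDiff I 𝓘(ℝ, E →L[ℝ] E) ∞ A)
    {c : X → E} (hc : ContMDiff I 𝓘(ℝ, E) ∞ c) {x₀ : X} {b₀ : E} (hb₀ : A x₀ b₀ = c x₀) :
    ∃ b : X → E, b x₀ = b₀ ∧ ∀ᶠ x in 𝓝 x₀, ContMDiffAt I 𝓘(ℝ, E) ∞ b x ∧
      (Module.finrank ℝ (A x).toLinearMap.ker = Module.finrank ℝ (A x₀).toLinearMap.ker →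
        c x ∈ (A x).toLinearMap.range → A x (b x) = c x) := by
  obtain ⟨G, h1, h2⟩ := exists_generalizedInverse (A x₀)
  let T : X → E →L[ℝ] E := fun x ↦ G.comp (A x) + (1 - G.comp (A x₀))
  have hT : ContMDiff I 𝓘(ℝ, E →L[ℝ] E) ∞ T :=
    (contMDiff_const.clm_comp hA).add contMDiff_const
  have hT₀ : T x₀ = 1 := by simp [T]
  -- The constant part b₀ - G(c x₀) lies in ker A(x₀), because c x₀ = A(x₀) b₀.
  refine ⟨fun x ↦ Ring.inverse (T x) (b₀ - G (c x₀) + G (c x)), by simp [hT₀], ?_⟩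
  have hunit : ∀ᶠ x in 𝓝 x₀, IsUnit (T x) :=
    hT.continuous.continuousAt.eventually (Units.isOpen.mem_nhds (by simp [hT₀]))
  filter_upwards [hunit] with x hx
  constructor
  · have hinv : ContMDiffAt I 𝓘(ℝ, E →L[ℝ] E) ∞ (fun x ↦ Ring.inverse (T x)) x := by
      obtain ⟨u, hu⟩ := hx
      have := contDiffAt_ringInverse ℝ (n := ∞) u
      rw [hu] at this
      exact this.contMDiffAt.comp x hT.contMDiffAt
    exact hinv.clm_apply (contMDiffAt_const.add
      (contMDiffAt_const.clm_apply hc.contMDiffAt))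
  · intro hr hcx
    have hl : ∀ v, Ring.inverse (T x) (T x v) = v := fun v ↦
      congrArg (fun L : E →L[ℝ] E ↦ L v) (Ring.inverse_mul_cancel _ hx)
    have hr' : ∀ v, T x (Ring.inverse (T x) v) = v := fun v ↦
      congrArg (fun L : E →L[ℝ] E ↦ L v) (Ring.mul_inverse_cancel _ hx)
    refine apply_eq_of_finrank_ker_eq (w := b₀ - G (c x₀)) h1 h2 hr
      (fun u v huv ↦ ?_) hcx ?_ ?_
    · rw [← hl u, ← hl v]
      exact congrArg _ huv
    · rw [map_sub, ← hb₀, h1, sub_self]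
    · exact hr' _

end GeneralizedInverse

/-! ### Differentials and bump functions -/

section Manifold

variable {m : ℕ} {M : Type*} [TopologicalSpace M] [ChartedSpace (EuclideanSpace ℝ (Fin m)) M]

theorem diff_congr {f g : Smooth m M} {x : M} (h : f =ᶠ[𝓝 x] g) : diff f x = diff g x := by
  simp only [diff, mvfderiv, h.mfderiv_eq]
  rw [h.eq_of_nhds]

theorem diff_zero (x : M) : diff (0 : Smooth m M) x = 0 :=
  mvfderiv_const 0

theorem diff_sum {ι : Type*} (s : Finset ι) (f : ι → Smooth m M) (x : M) :
    diff (∑ i ∈ s, f i) x = ∑ i ∈ s, diff (f i) x := by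
  classical
  induction s using Finset.induction_on with
  | empty => simp [diff_zero]
  | insert i s hi ih => rw [Finset.sum_insert hi, Finset.sum_insert hi, diff_add, ih]

theorem diff_mul_of_eq_zero (f g : Smooth m M) {x : M} (h : g x = 0) :
    diff (f * g) x = f x • diff g x := by
  rw [diff_mul, h, zero_smul, add_zero]

variable [IsManifold (𝓡 m) ∞ M]

/-- In a trivialization of the tangent bundle the differentials become continuous maps into a fixed
space, where independence is an open condition. -/
theorem eventually_linearIndependent_diff {k : ℕ} (g : Fin k → Smooth m M) {x : M}
    (h : LinearIndependent ℝ fun i ↦ diff (g i) x) :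
    ∀ᶠ y in 𝓝 x, LinearIndependent ℝ fun i ↦ diff (g i) y := by
  let s (y : M) : EuclideanSpace ℝ (Fin m) →L[ℝ] TangentSpace (𝓡 m) y :=
    (trivializationAt (EuclideanSpace ℝ (Fin m)) (TangentSpace (𝓡 m)) x).symmL ℝ y
  have hs : s x = ContinuousLinearMap.id ℝ _ := by
    simp only [s]
    rw [TangentBundle.symmL_trivializationAt (by simp)]
    exact mfderivWithin_range_extChartAt_symm
  let D (y : M) (i : Fin k) : EuclideanSpace ℝ (Fin m) →L[ℝ] ℝ := (diff (g i) y).comp (s y)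
  have hD : ContinuousAt D x := by
    refine continuousAt_pi.2 fun i ↦ ?_
    have := (contMDiffAt_hom_bundle _).1 (contMDiff_diff (g i) x)
    convert this.2.continuousAt using 1
    ext y v
    simp [D, s, ContinuousLinearMap.inCoordinates]
  have hDx : LinearIndependent ℝ (D x) := by
    have : D x = fun i ↦ diff (g i) x := by
      ext i v
      simp only [D, hs]
      rfl
    rw [this]
    exact h
  filter_upwards [hD.eventually hDx.eventually] with y hy
  let pre : Cotangent m y →ₗ[ℝ] (EuclideanSpace ℝ (Fin m) →L[ℝ] ℝ) :=
    { toFun := fun φ ↦ φ.comp (s y)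
      map_add' := fun _ _ ↦ rfl
      map_smul' := fun _ _ ↦ rfl }
  exact LinearIndependent.of_comp pre hy

variable [T2Space M]

theorem exists_smooth_eventuallyEq {f : M → ℝ} {x : M} {U : Set M} (hU : U ∈ 𝓝 x)
    (hf : ∀ y ∈ U, ContMDiffAt (𝓡 m) 𝓘(ℝ) ∞ f y) :
    ∃ g : Smooth m M, g =ᶠ[𝓝 x] f ∧ (∀ y ∉ U, g y = 0) ∧ ∀ y, f y = 0 → g y = 0 := by
  obtain ⟨χ, hχ, -⟩ := (SmoothBumpFunction.nhds_basis_support (I := 𝓡 m) hU).mem_iff.1 hU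
  refine ⟨⟨fun y ↦ χ y • f y, contMDiff_of_tsupport fun y hy ↦ ?_⟩, ?_, fun y hy ↦ ?_,
    fun y hy ↦ ?_⟩
  · exact χ.contMDiffAt.smul (hf y (hχ (tsupport_smul_subset_left _ _ hy)))
  · filter_upwards [χ.eventuallyEq_one] with y hy
    change χ y • f y = f y
    simp [hy]
  · change χ y • f y = 0
    rw [image_eq_zero_of_notMem_tsupport fun h ↦ hy (hχ h), zero_smul]
  · change χ y • f y = 0
    rw [hy, smul_zero]

theorem exists_smooth_bump {x : M} {U : Set M} (hU : U ∈ 𝓝 x) :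
    ∃ χ : Smooth m M, χ x = 1 ∧ ∀ y ∉ U, χ y = 0 := by
  obtain ⟨g, h1, h2, -⟩ := exists_smooth_eventuallyEq (m := m) (f := fun _ ↦ 1) hU
    fun y _ ↦ contMDiffAt_const
  exact ⟨g, h1.eq_of_nhds, h2⟩

end Manifold

/-! ### Embedded submanifolds in adapted charts -/

section Embedding

variable {m n : ℕ} {M : Type*} [TopologicalSpace M] [ChartedSpace (EuclideanSpace ℝ (Fin m)) M]
  {N : Type*} [TopologicalSpace N] [ChartedSpace (EuclideanSpace ℝ (Fin n)) N] {ι : N → M}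

theorem mdifferentiable_of_mem_maximalAtlas {e : OpenPartialHomeomorph M (EuclideanSpace ℝ (Fin m))}
    (he : e ∈ IsManifold.maximalAtlas (𝓡 m) ∞ M) : e.MDifferentiable (𝓡 m) (𝓡 m) := by
  have he' : e ∈ IsManifold.maximalAtlas (𝓡 m) 1 M :=
    IsManifold.maximalAtlas_subset_of_le (by simp) he
  exact ⟨fun x hx ↦ (mdifferentiableAt_of_mem_maximalAtlas he' hx).mdifferentiableWithinAt,
    fun x hx ↦ (mdifferentiableAt_symm_of_mem_maximalAtlas he' hx).mdifferentiableWithinAt⟩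

theorem exists_adapted_charts (hι : IsSmoothEmbedding (𝓡 n) (𝓡 m) ∞ ι) (p : N) :
    ∃ (L : EuclideanSpace ℝ (Fin n) →L[ℝ] EuclideanSpace ℝ (Fin m))
      (e : OpenPartialHomeomorph N (EuclideanSpace ℝ (Fin n)))
      (e' : OpenPartialHomeomorph M (EuclideanSpace ℝ (Fin m))),
      Function.Injective L ∧ p ∈ e.source ∧ ι p ∈ e'.source ∧
      e ∈ IsManifold.maximalAtlas (𝓡 n) ∞ N ∧ e' ∈ IsManifold.maximalAtlas (𝓡 m) ∞ M ∧
      ∀ q ∈ e.source, e' (ι q) = L (e q) := by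
  have h := hι.isImmersion.isImmersionAt p
  refine ⟨h.equiv.toContinuousLinearMap.comp (ContinuousLinearMap.inl ℝ _ _), h.domChart,
    h.codChart, ?_, h.mem_domChart_source, h.mem_codChart_source, h.domChart_mem_maximalAtlas,
    h.codChart_mem_maximalAtlas, fun q hq ↦ ?_⟩
  · exact h.equiv.injective.comp fun u v huv ↦ congrArg Prod.fst huv
  · have hq' : q ∈ (h.domChart.extend (𝓡 n)).source := by simpa using hq
    have := h.writtenInCharts ((h.domChart.extend (𝓡 n)).map_source hq')
    simp only [Function.comp_apply, (h.domChart.extend (𝓡 n)).left_inv hq'] at this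
    exact this

theorem mfderiv_adapted {L : EuclideanSpace ℝ (Fin n) →L[ℝ] EuclideanSpace ℝ (Fin m)}
    {e : OpenPartialHomeomorph N (EuclideanSpace ℝ (Fin n))}
    {e' : OpenPartialHomeomorph M (EuclideanSpace ℝ (Fin m))}
    (hι : IsSmoothEmbedding (𝓡 n) (𝓡 m) ∞ ι) {p : N} (hp : p ∈ e.source) (hp' : ι p ∈ e'.source)
    (he : e ∈ IsManifold.maximalAtlas (𝓡 n) ∞ N) (he' : e' ∈ IsManifold.maximalAtlas (𝓡 m) ∞ M)
    (hL : ∀ q ∈ e.source, e' (ι q) = L (e q)) (v : TangentSpace (𝓡 n) p) :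
    mfderiv (𝓡 m) (𝓡 m) e' (ι p) (mfderiv (𝓡 n) (𝓡 m) ι p v) =
      L (mfderiv (𝓡 n) (𝓡 n) e p v) := by
  have h1 : e' ∘ ι =ᶠ[𝓝 p] L ∘ e :=
    Filter.eventually_of_mem (e.open_source.mem_nhds hp) hL
  have h2 := mfderiv_comp p ((mdifferentiable_of_mem_maximalAtlas he').mdifferentiableAt hp')
    (hι.contMDiff.mdifferentiable (by simp) p)
  have h3 := mfderiv_comp p (L.differentiableAt (x := e p)).mdifferentiableAt
    ((mdifferentiable_of_mem_maximalAtlas he).mdifferentiableAt hp)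
  rw [h1.mfderiv_eq, h3, mfderiv_eq_fderiv, L.fderiv] at h2
  exact (congrArg (fun T ↦ T v) h2).symm

theorem injective_mfderiv (hι : IsSmoothEmbedding (𝓡 n) (𝓡 m) ∞ ι) (p : N) :
    Function.Injective (mfderiv (𝓡 n) (𝓡 m) ι p) := by
  obtain ⟨L, e, e', hL, hp, hp', he, he', h⟩ := exists_adapted_charts hι p
  intro u v huv
  apply (mdifferentiable_of_mem_maximalAtlas he).mfderiv_injective hp
  apply hL
  rw [← mfderiv_adapted hι hp hp' he he' h, ← mfderiv_adapted hι hp hp' he he' h, huv]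

/-- Every conormal covector is the differential of a function that vanishes on the submanifold. -/
theorem exists_mem_vanishingIdeal_diff_eq [IsManifold (𝓡 m) ∞ M] [T2Space M] (hι : IsSmoothEmbedding (𝓡 n) (𝓡 m) ∞ ι)
    {p : N} {α : Cotangent m (ι p)} (hα : α ∈ conormal m n ι p) :
    ∃ f ∈ vanishingIdeal m ι, diff f (ι p) = α := by
  obtain ⟨L, e, e', -, hp, hp', he, he', h⟩ := exists_adapted_charts hι p
  have hd := mdifferentiable_of_mem_maximalAtlas he
  have hd' := mdifferentiable_of_mem_maximalAtlas he'
  let T := hd'.mfderiv hp'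
  let β : EuclideanSpace ℝ (Fin m) →L[ℝ] ℝ := α.comp T.symm.toContinuousLinearMap
  have hβ (v) : β (mfderiv (𝓡 m) (𝓡 m) e' (ι p) v) = α v :=
    congrArg α (T.symm_apply_apply v)
  have hβL (u) : β (L u) = 0 := by
    obtain ⟨v, rfl⟩ := hd.mfderiv_surjective hp u
    rw [← mfderiv_adapted hι hp hp' he he' h, hβ]
    exact hα _ ⟨v, rfl⟩
  -- The embedding supplies a neighbourhood O meeting N only inside the chart domain, so no other
  -- sheet of N enters.
  obtain ⟨O, hO, hOe⟩ := hι.isEmbedding.isInducing.isOpen_iff.1 e.open_source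
  have hpO : ι p ∈ O := by
    change p ∈ ι ⁻¹' O
    rwa [hOe]
  have hU : O ∩ e'.source ∈ 𝓝 (ι p) := (hO.inter e'.open_source).mem_nhds ⟨hpO, hp'⟩
  obtain ⟨f, hf1, hf2, hf3⟩ := exists_smooth_eventuallyEq (m := m) (f := β ∘ e') hU fun y hy ↦
    β.contDiff.contMDiff.contMDiffAt.comp y (contMDiffAt_of_mem_maximalAtlas he' hy.2)
  refine ⟨f, fun q ↦ ?_, ?_⟩
  · by_cases hq : ι q ∈ O ∩ e'.source
    · refine hf3 _ ?_
      have hqe : q ∈ e.source := hOe ▸ hq.1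
      simp only [Function.comp_apply, h q hqe, hβL]
    · exact hf2 _ hq
  · have h1 := mfderiv_comp (ι p) (β.differentiableAt (x := e' (ι p))).mdifferentiableAt
      (hd'.mdifferentiableAt hp')
    rw [mfderiv_eq_fderiv, β.fderiv, ← hf1.mfderiv_eq] at h1
    ext v
    refine Eq.trans ?_ (hβ v)
    exact congrArg (fun S ↦ S v) h1

end Embedding

/-! ### The radical of Π on the conormal space -/

section Radical

variable {m n : ℕ} {M : Type*} [TopologicalSpace M] [ChartedSpace (EuclideanSpace ℝ (Fin m)) M]
  {N : Type*} [TopologicalSpace N] [ChartedSpace (EuclideanSpace ℝ (Fin n)) N] {ι : N → M}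

instance (x : M) : FiniteDimensional ℝ (TangentSpace (𝓡 m) x) :=
  inferInstanceAs (FiniteDimensional ℝ (EuclideanSpace ℝ (Fin m)))

instance (x : M) : T2Space (TangentSpace (𝓡 m) x) :=
  inferInstanceAs (T2Space (EuclideanSpace ℝ (Fin m)))

instance (x : M) : FiniteDimensional ℝ (Cotangent m x) :=
  finiteDimensional_continuousDual

theorem finrank_tangentSpace (x : M) : Module.finrank ℝ (TangentSpace (𝓡 m) x) = m :=
  finrank_euclideanSpace_fin (𝕜 := ℝ) (n := m)

theorem conormal_eq_annihilator (p : N) :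
    conormal m n ι p = annihilator (tangentN m n ι p) := by
  ext α
  rw [mem_annihilator]
  rfl

theorem mem_tangentN_of_forall_conormal {p : N} {v : TangentSpace (𝓡 m) (ι p)}
    (h : ∀ α ∈ conormal m n ι p, α v = 0) : v ∈ tangentN m n ι p :=
  mem_of_forall_annihilator (conormal_eq_annihilator (m := m) (n := n) (ι := ι) p ▸ h)

theorem diff_mem_conormal (hι : MDifferentiable (𝓡 n) (𝓡 m) ι) {f : Smooth m M}
    [IsManifold (𝓡 m) ∞ M] (hf : f ∈ vanishingIdeal m ι) (p : N) :
    diff f (ι p) ∈ conormal m n ι p := by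
  rintro _ ⟨v, rfl⟩
  have h1 := mvfderiv_comp p ((f.contMDiff (ι p)).mdifferentiableAt (by simp)) (hι p)
  have h2 : ⇑f ∘ ι = fun _ ↦ (0 : ℝ) := funext hf
  rw [h2, mvfderiv_const] at h1
  exact (congrArg (fun S ↦ S v) h1).symm

variable [IsManifold (𝓡 m) ∞ M]

/-- The radical of the restriction of `Π` to the conormal space. -/
def conormalRadical (n : ℕ) [ChartedSpace (EuclideanSpace ℝ (Fin n)) N] (P : PoissonStructure m M)
    (ι : N → M) (p : N) : Submodule ℝ (Cotangent m (ι p)) :=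
  (tangentN m n ι p).comap (P.sharp (ι p)).toLinearMap ⊓ conormal m n ι p

variable (P : PoissonStructure m M)

theorem annihilator_map_conormal_sup (p : N) :
    annihilator ((conormal m n ι p).map (P.sharp (ι p)).toLinearMap ⊔ tangentN m n ι p) =
      conormalRadical n P ι p := by
  rw [conormalRadical, conormal_eq_annihilator]
  exact annihilator_map_sup _ (P.skew (ι p)) _

theorem finrank_add_finrank_conormalRadical (p : N) :
    Module.finrank ℝ
      ↥((conormal m n ι p).map (P.sharp (ι p)).toLinearMap ⊔ tangentN m n ι p) +
      Module.finrank ℝ (conormalRadical n P ι p) = m := by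
  rw [← annihilator_map_conormal_sup, finrank_add_finrank_annihilator]
  exact finrank_tangentSpace (ι p)

theorem constantRank_iff : ConstantRank n P ι ↔
    ∃ d : ℕ, ∀ p : N, Module.finrank ℝ (conormalRadical n P ι p) = d := by
  constructor <;> rintro ⟨d, hd⟩ <;> refine ⟨m - d, fun p ↦ ?_⟩ <;>
  · have h1 := finrank_add_finrank_conormalRadical (n := n) (ι := ι) P p
    have h2 := hd p
    omega

/-- A vector that is killed by the radical is tangent to the submanifold up to the image of
a conormal covector. -/
theorem exists_conormal_sharp_add_mem {p : N} {α : Cotangent m (ι p)}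
    (h : ∀ β ∈ conormalRadical n P ι p, β (P.sharp (ι p) α) = 0) :
    ∃ β ∈ conormal m n ι p, P.sharp (ι p) (α + β) ∈ tangentN m n ι p := by
  rw [← annihilator_map_conormal_sup] at h
  obtain ⟨_, ⟨β, hβ, rfl⟩, w, hw, hvw⟩ := Submodule.mem_sup.1 (mem_of_forall_annihilator h)
  refine ⟨-β, neg_mem hβ, ?_⟩
  rw [map_add, map_neg, ← hvw]
  simpa using hw

end Radical

/-! ### Conormal frames -/

section Frame

variable {m n : ℕ} {M : Type*} [TopologicalSpace M] [ChartedSpace (EuclideanSpace ℝ (Fin m)) M]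
  {N : Type*} [TopologicalSpace N] [ChartedSpace (EuclideanSpace ℝ (Fin n)) N] {ι : N → M}

theorem finrank_conormal (hι : IsSmoothEmbedding (𝓡 n) (𝓡 m) ∞ ι) (p : N) :
    n + Module.finrank ℝ (conormal m n ι p) = m := by
  have h1 := finrank_add_finrank_annihilator (tangentN m n ι p)
  rw [← conormal_eq_annihilator] at h1
  have h2 : Module.finrank ℝ (tangentN m n ι p) = n :=
    (LinearMap.finrank_range_of_inj (injective_mfderiv hι p)).trans (finrank_tangentSpace p)
  rw [h2] at h1
  exact h1.trans (finrank_tangentSpace (ι p))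

/-- A basis at p still spans wherever it stays independent, since all conormal spaces have dimension
m - n. -/
theorem exists_conormal_frame [IsManifold (𝓡 m) ∞ M] [T2Space M]
    (hι : IsSmoothEmbedding (𝓡 n) (𝓡 m) ∞ ι) (p : N) :
    ∃ (d : ℕ) (y : Fin d → Smooth m M), (∀ i, y i ∈ vanishingIdeal m ι) ∧
      (LinearIndependent ℝ fun i ↦ diff (y i) (ι p)) ∧
      ∀ q : N, (LinearIndependent ℝ fun i ↦ diff (y i) (ι q)) →
        Submodule.span ℝ (Set.range fun i ↦ diff (y i) (ι q)) = conormal m n ι q := by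
  obtain ⟨e, he, heS⟩ := exists_linearIndependent_fin (conormal m n ι p)
  choose y hyI hy using fun i ↦ exists_mem_vanishingIdeal_diff_eq hι (heS i)
  refine ⟨_, y, hyI, ?_, fun q hq ↦ ?_⟩
  · simpa only [hy] using he
  · refine span_eq_of_linearIndependent ?_ hq fun i ↦
      diff_mem_conormal (hι.contMDiff.mdifferentiable (by simp)) (hyI i) q
    have h1 := finrank_conormal hι p
    have h2 := finrank_conormal hι q
    omega

end Frame

/-! ### The matrix of brackets of a conormal frame -/

section BracketMatrix

variable {m n : ℕ} {M : Type*} [TopologicalSpace M] [ChartedSpace (EuclideanSpace ℝ (Fin m)) M]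
  {d : ℕ}

variable {N : Type*} [TopologicalSpace N] [ChartedSpace (EuclideanSpace ℝ (Fin n)) N] {ι : N → M}

theorem sharp_mem_tangentN_of_span (y : Fin d → Smooth m M) {q : N}
    (hs : Submodule.span ℝ (Set.range fun i ↦ diff (y i) (ι q)) = conormal m n ι q)
    {v : TangentSpace (𝓡 m) (ι q)} (h : ∀ i, diff (y i) (ι q) v = 0) : v ∈ tangentN m n ι q := by
  refine mem_tangentN_of_forall_conormal fun α hα ↦ ?_
  rw [← hs, Submodule.mem_span_range_iff_exists_fun] at hα
  obtain ⟨a, rfl⟩ := hα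
  simp [h]

variable [IsManifold (𝓡 m) ∞ M] (P : PoissonStructure m M) (y : Fin d → Smooth m M)

/-- The linear endomorphism given by the matrix of the brackets `{y j, y i}` at `x`. -/
def bracketMatrix (x : M) : (Fin d → ℝ) →L[ℝ] (Fin d → ℝ) :=
  ∑ i, ∑ j, P.bracket (y j) (y i) x •
    (ContinuousLinearMap.proj (R := ℝ) (φ := fun _ : Fin d ↦ ℝ) j).smulRight (Pi.single i (1 : ℝ))

theorem contMDiff_bracketMatrix :
    ContMDiff (𝓡 m) 𝓘(ℝ, (Fin d → ℝ) →L[ℝ] (Fin d → ℝ)) ∞ (bracketMatrix P y) := by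
  unfold bracketMatrix
  exact contMDiff_finsetSum fun i _ ↦ contMDiff_finsetSum fun j _ ↦
    (P.bracket (y j) (y i)).contMDiff.smul contMDiff_const

theorem bracketMatrix_apply (x : M) (a : Fin d → ℝ) (i : Fin d) :
    bracketMatrix P y x a i = diff (y i) x (P.sharp x (∑ j, a j • diff (y j) x)) := by
  simp only [bracketMatrix, sum_apply, smul_apply,
    Finset.sum_apply, Pi.smul_apply, ContinuousLinearMap.smulRight_apply,
    ContinuousLinearMap.proj_apply, smul_eq_mul, Pi.single_apply, mul_ite, mul_one, mul_zero,
    map_sum, map_smul, BivectorField.bracket_apply]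
  rw [Finset.sum_eq_single i (fun k _ hk ↦ by simp [Ne.symm hk]) (by simp)]
  simp [mul_comm]

theorem finrank_ker_bracketMatrix {q : N}
    (hq : LinearIndependent ℝ fun i ↦ diff (y i) (ι q))
    (hs : Submodule.span ℝ (Set.range fun i ↦ diff (y i) (ι q)) = conormal m n ι q) :
    Module.finrank ℝ (bracketMatrix P y (ι q)).toLinearMap.ker =
      Module.finrank ℝ (conormalRadical n P ι q) := by
  let Φ : (Fin d → ℝ) →ₗ[ℝ] Cotangent m (ι q) :=
    Fintype.linearCombination ℝ fun i ↦ diff (y i) (ι q)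
  have hΦ : Function.Injective Φ := linearIndependent_iff_injective_fintypeLinearCombination.1 hq
  have hy (i) : diff (y i) (ι q) ∈ conormal m n ι q := hs ▸ Submodule.subset_span ⟨i, rfl⟩
  have hmap : (bracketMatrix P y (ι q)).toLinearMap.ker.map Φ = conormalRadical n P ι q := by
    ext α
    constructor
    · rintro ⟨a, ha, rfl⟩
      refine ⟨sharp_mem_tangentN_of_span y hs fun i ↦ ?_, ?_⟩
      · have := congrFun (LinearMap.mem_ker.1 ha) i
        exact (bracketMatrix_apply P y _ a i).symm.trans this
      · exact sum_mem fun i _ ↦ Submodule.smul_mem _ _ (hy i)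
    · rintro ⟨h1, h2⟩
      have h3 := h2
      rw [SetLike.mem_coe, ← hs, Submodule.mem_span_range_iff_exists_fun] at h3
      obtain ⟨a, rfl⟩ := h3
      refine ⟨a, LinearMap.mem_ker.2 (funext fun i ↦ ?_), rfl⟩
      exact (bracketMatrix_apply P y _ a i).trans (hy i _ h1)
  rw [← hmap]
  exact (Submodule.equivMapOfInjective Φ hΦ _).finrank_eq

end BracketMatrix

/-! ### First-class functions and the three claims -/

section Constraints

variable {m n : ℕ} {M : Type*} [TopologicalSpace M] [ChartedSpace (EuclideanSpace ℝ (Fin m)) M]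
  [IsManifold (𝓡 m) ∞ M] [T2Space M] (P : PoissonStructure m M) {N : Type*} [TopologicalSpace N]
  [ChartedSpace (EuclideanSpace ℝ (Fin n)) N] {ι : N → M}

/-- The differentials of functions in ℐ exhaust the conormal space, and a vector killed by all
conormal covectors is tangent. -/
theorem mem_firstClass_iff (hι : IsSmoothEmbedding (𝓡 n) (𝓡 m) ∞ ι) {f : Smooth m M} :
    f ∈ firstClass P ι ↔ ∀ q, P.sharp (ι q) (diff f (ι q)) ∈ tangentN m n ι q := by
  constructor
  · intro hf q
    refine mem_tangentN_of_forall_conormal fun α hα ↦ ?_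
    obtain ⟨h, hh, rfl⟩ := exists_mem_vanishingIdeal_diff_eq hι hα
    exact hf h hh q
  · intro hf h hh q
    exact diff_mem_conormal (hι.contMDiff.mdifferentiable (by simp)) hh q _ (hf q)

theorem diff_mem_conormalRadical (hι : IsSmoothEmbedding (𝓡 n) (𝓡 m) ∞ ι) {g : Smooth m M}
    (hg : g ∈ firstClassConstraints P ι) (q : N) :
    diff g (ι q) ∈ conormalRadical n P ι q :=
  ⟨(mem_firstClass_iff P hι).1 hg.1 q,
    diff_mem_conormal (hι.contMDiff.mdifferentiable (by simp)) hg.2 q⟩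

/-- Under the constant rank condition, the pointwise problem of correcting the differential of `f`
by a conormal covector, so that its Hamiltonian vector becomes tangent to the submanifold, has
local solutions by functions that vanish on the submanifold, with prescribed value at a point. -/
theorem exists_local_correction (hι : IsSmoothEmbedding (𝓡 n) (𝓡 m) ∞ ι)
    (hP : ConstantRank n P ι) {f : Smooth m M}
    (hf : ∀ q, ∀ β ∈ conormalRadical n P ι q, β (P.sharp (ι q) (diff f (ι q))) = 0)
    {p : N} {α : Cotangent m (ι p)} (hα : α ∈ conormal m n ι p)
    (hfα : P.sharp (ι p) (diff f (ι p) + α) ∈ tangentN m n ι p) :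
    ∃ g ∈ vanishingIdeal m ι, diff g (ι p) = α ∧ ∀ᶠ x in 𝓝 (ι p), ∀ q, ι q = x →
      P.sharp (ι q) (diff f (ι q) + diff g (ι q)) ∈ tangentN m n ι q := by
  obtain ⟨r, hr⟩ := (constantRank_iff P).1 hP
  obtain ⟨d, y, hyI, hyp, hys⟩ := exists_conormal_frame hι p
  have hy (q i) : diff (y i) (ι q) ∈ conormal m n ι q :=
    diff_mem_conormal (hι.contMDiff.mdifferentiable (by simp)) (hyI i) q
  have hcoord {q : N} (hq : LinearIndependent ℝ fun i ↦ diff (y i) (ι q))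
      {β : Cotangent m (ι q)} (hβ : β ∈ conormal m n ι q) :
      ∃ a : Fin d → ℝ, ∑ i, a i • diff (y i) (ι q) = β := by
    rwa [← hys q hq, Submodule.mem_span_range_iff_exists_fun] at hβ
  let c (x : M) (i : Fin d) : ℝ := - P.bracket f (y i) x
  have hc : ContMDiff (𝓡 m) 𝓘(ℝ, Fin d → ℝ) ∞ c :=
    contMDiff_pi_space.2 fun i ↦ (P.bracket f (y i)).contMDiff.neg
  have hsolve {q : N} {a : Fin d → ℝ}
      (ha : P.sharp (ι q) (diff f (ι q) + ∑ i, a i • diff (y i) (ι q)) ∈ tangentN m n ι q) :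
      bracketMatrix P y (ι q) a = c (ι q) := by
    ext i
    have := hy q i _ ha
    rw [map_add, map_add] at this
    rw [bracketMatrix_apply]
    exact eq_neg_of_add_eq_zero_right this
  obtain ⟨b₀, hb₀⟩ := hcoord hyp hα
  rw [← hb₀] at hfα
  obtain ⟨b, hbp, hb⟩ :=
    exists_smooth_local_solution (contMDiff_bracketMatrix P y) hc (hsolve hfα)
  choose g hg _ _ using fun i ↦ exists_smooth_eventuallyEq (m := m) (f := fun x ↦ b x i) hb
    fun x hx ↦ contMDiffAt_pi_space.1 hx.1 i
  -- Since y_i = 0 on N, the derivatives of the coefficients g_i drop out.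
  have hgdiff (q : N) : diff (∑ i, g i * y i) (ι q) = ∑ i, g i (ι q) • diff (y i) (ι q) := by
    rw [diff_sum]
    exact Finset.sum_congr rfl fun i _ ↦ diff_mul_of_eq_zero _ _ (hyI i q)
  refine ⟨∑ i, g i * y i, sum_mem fun i _ ↦ Ideal.mul_mem_left _ _ (hyI i), ?_, ?_⟩
  · rw [hgdiff, ← hb₀]
    exact Finset.sum_congr rfl fun i _ ↦ by rw [(hg i).eq_of_nhds, hbp]
  · filter_upwards [hb, eventually_all.2 hg, eventually_linearIndependent_diff y hyp]
      with x hx hgx hyx q hq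
    subst hq
    refine sharp_mem_tangentN_of_span y (hys q hyx) fun i ↦ ?_
    -- Pointwise solvability puts c in the range of the bracket matrix at q.
    obtain ⟨β, hβ, hfβ⟩ := exists_conormal_sharp_add_mem P (hf q)
    obtain ⟨a, rfl⟩ := hcoord hyx hβ
    have h := hx.2 (by rw [finrank_ker_bracketMatrix P y hyx (hys q hyx),
      finrank_ker_bracketMatrix P y hyp (hys p hyp), hr, hr]) ⟨a, hsolve hfβ⟩
    have hi := congrFun h i
    rw [bracketMatrix_apply] at hi
    rw [hgdiff, map_add, map_add]
    simp only [hgx]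
    rw [hi]
    exact add_neg_cancel _

theorem spannedByConstraints_of_constantRank (hι : IsSmoothEmbedding (𝓡 n) (𝓡 m) ∞ ι)
    (hP : ConstantRank n P ι) : SpannedByConstraints n P ι := by
  intro p
  ext α
  constructor
  · rintro ⟨h1, h2⟩
    -- For f = 0 the system is homogeneous, and its solutions are the elements of the radical.
    obtain ⟨g, hgI, hgα, hg⟩ := exists_local_correction P hι hP (f := 0)
      (fun q β _ ↦ by simp [diff_zero]) h2 (by rw [diff_zero, zero_add]; exact h1)
    obtain ⟨χ, hχ, hχ0⟩ := exists_smooth_bump (m := m) hg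
    have hd (q : N) : diff (χ * g) (ι q) = χ (ι q) • diff g (ι q) :=
      diff_mul_of_eq_zero _ _ (hgI q)
    refine ⟨χ * g, ⟨(mem_firstClass_iff P hι).2 fun q ↦ ?_, Ideal.mul_mem_left _ _ hgI⟩, ?_⟩
    · rw [hd, map_smul]
      by_cases hq : χ (ι q) = 0
      · rw [hq, zero_smul]
        exact zero_mem _
      · have := not_imp_comm.1 (hχ0 (ι q)) hq q rfl
        rw [diff_zero, zero_add] at this
        exact Submodule.smul_mem _ _ this
    · rw [hd, hχ, one_smul, hgα]
  · rintro ⟨g, hg, rfl⟩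
    exact diff_mem_conormalRadical P hι hg p

theorem constantRank_of_spannedByConstraints [PreconnectedSpace N]
    (hι : IsSmoothEmbedding (𝓡 n) (𝓡 m) ∞ ι) (hP : SpannedByConstraints n P ι) :
    ConstantRank n P ι := by
  rw [constantRank_iff]
  have hloc : IsLocallyConstant fun p ↦ Module.finrank ℝ (conormalRadical n P ι p) := by
    refine IsLocallyConstant.iff_eventually_eq _ |>.2 fun p ↦ ?_
    obtain ⟨e, he, heS⟩ := exists_linearIndependent_fin (conormalRadical n P ι p)
    choose g hg hge using fun i ↦ (hP p).subset (heS i)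
    have hgp : LinearIndependent ℝ fun i ↦ diff (g i) (ι p) := by
      simpa only [hge] using he
    obtain ⟨d, y, hyI, hyp, hys⟩ := exists_conormal_frame hι p
    -- Matrix rank cannot drop near p, so the kernel dimension cannot grow.
    have hrank := (contMDiff_bracketMatrix P y).continuous.continuousAt.eventually
      ((isOpen_setOfPred_nat_le_rank
        (Module.finrank ℝ (bracketMatrix P y (ι p)).toLinearMap.range)).mem_nhds
        (Module.finrank_eq_rank ℝ _).le)
    have hcont : Tendsto ι (𝓝 p) (𝓝 (ι p)) := hι.contMDiff.continuous.continuousAt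
    filter_upwards [hcont.eventually (eventually_linearIndependent_diff g hgp),
      hcont.eventually (eventually_linearIndependent_diff y hyp), hcont.eventually hrank]
      with q hgq hyq hq
    have h1 := finrank_ker_bracketMatrix P y hyp (hys p hyp)
    have h2 := finrank_ker_bracketMatrix P y hyq (hys q hyq)
    have h3 := (bracketMatrix P y (ι p)).toLinearMap.finrank_range_add_finrank_ker
    have h4 := (bracketMatrix P y (ι q)).toLinearMap.finrank_range_add_finrank_ker
    have h5 : Module.finrank ℝ (bracketMatrix P y (ι p)).toLinearMap.range ≤
        Module.finrank ℝ (bracketMatrix P y (ι q)).toLinearMap.range := by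
      rw [LinearMap.rank, ← Module.finrank_eq_rank] at hq
      exact_mod_cast hq
    have h6 : Module.finrank ℝ (conormalRadical n P ι p) ≤
        Module.finrank ℝ (conormalRadical n P ι q) :=
      le_finrank_of_linearIndependent hgq fun i ↦ diff_mem_conormalRadical P hι (hg i) q
    omega
  rcases isEmpty_or_nonempty N with hN | ⟨⟨p⟩⟩
  · exact ⟨0, fun p ↦ hN.elim p⟩
  · exact ⟨_, fun q ↦ hloc.apply_eq_of_preconnectedSpace q p⟩

variable [SecondCountableTopology M]

/-- Under the constant rank condition, every gauge invariant function agrees on the submanifold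
with a first-class function. -/
theorem exists_firstClass_sub_mem_vanishingIdeal (hι : IsSmoothEmbedding (𝓡 n) (𝓡 m) ∞ ι)
    (hclosed : IsClosed (Set.range ι)) (hP : ConstantRank n P ι) {f : Smooth m M}
    (hf : f ∈ gaugeInvariant P ι) :
    ∃ f' ∈ firstClass P ι, f' - f ∈ vanishingIdeal m ι := by
  have hf' (q : N) (β) (hβ : β ∈ conormalRadical n P ι q) :
      β (P.sharp (ι q) (diff f (ι q))) = 0 := by
    obtain ⟨g, hg, rfl⟩ := (spannedByConstraints_of_constantRank P hι hP q).subset hβ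
    exact hf g hg q
  have hex (p : N) : ∃ g ∈ vanishingIdeal m ι, ∀ᶠ x in 𝓝 (ι p), ∀ q, ι q = x →
      P.sharp (ι q) (diff f (ι q) + diff g (ι q)) ∈ tangentN m n ι q := by
    obtain ⟨α, hα, hfα⟩ := exists_conormal_sharp_add_mem P (hf' p)
    obtain ⟨g, hg, -, h⟩ := exists_local_correction P hι hP hf' hα hfα
    exact ⟨g, hg, h⟩
  choose g hgI hg using hex
  simp only [eventually_nhds_iff] at hg
  choose U hgU hUo hpU using hg
  have : LocallyCompactSpace M := ChartedSpace.locallyCompactSpace (EuclideanSpace ℝ (Fin m)) M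
  obtain ⟨ρ, hρ⟩ := SmoothPartitionOfUnity.exists_isSubordinate (𝓡 m) hclosed U hUo
    (by rintro _ ⟨p, rfl⟩; exact Set.mem_iUnion.2 ⟨p, hpU p⟩)
  let G : Smooth m M := ⟨fun x ↦ ∑ᶠ i, ρ i x • g i x,
    ρ.contMDiff_finsum_smul fun i x _ ↦ (g i).contMDiff x⟩
  have hGI : G ∈ vanishingIdeal m ι := fun q ↦ by
    change ∑ᶠ i, ρ i (ι q) • g i (ι q) = 0
    simp [hgI _ q]
  have hGdiff (q : N) : diff G (ι q) =
      ∑ i ∈ ρ.fintsupport (ι q), ρ i (ι q) • diff (g i) (ι q) := by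
    -- Near ι q the sum runs over one fixed finite index set, so it can be differentiated termwise.
    have h : G =ᶠ[𝓝 (ι q)] ⇑(∑ i ∈ ρ.fintsupport (ι q), (ρ i : Smooth m M) * g i) := by
      filter_upwards [ρ.eventually_finsupport_subset (ι q)] with x hx
      change ∑ᶠ i, ρ i x • g i x = _
      rw [← ρ.sum_finsupport_smul_eq_finsum (φ := fun i ↦ g i),
        Finset.sum_subset hx fun i _ hi ↦ ?_]
      · exact (map_sum ((Pi.evalRingHom (fun _ : M ↦ ℝ) x).comp
          ContMDiffMap.coeFnRingHom) (fun i ↦ (ρ i : Smooth m M) * g i) _).symm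
      · rw [ρ.mem_finsupport, Function.notMem_support] at hi
        rw [hi, zero_smul]
    rw [diff_congr h, diff_sum]
    exact Finset.sum_congr rfl fun i _ ↦ diff_mul_of_eq_zero _ _ (hgI i q)
  refine ⟨f + G, (mem_firstClass_iff P hι).2 fun q ↦ ?_, by rwa [add_sub_cancel_left]⟩
  -- The weights sum to 1 on N, so df distributes over them and tangency can be checked term by
  -- term.
  have hsum : diff (f + G) (ι q) = ∑ i ∈ ρ.fintsupport (ι q),
      ρ i (ι q) • (diff f (ι q) + diff (g i) (ι q)) := by
    rw [diff_add, hGdiff]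
    simp only [smul_add, Finset.sum_add_distrib, ← Finset.sum_smul]
    rw [ρ.sum_finsupport' (ι q) ⟨q, rfl⟩ (ρ.finsupport_subset_fintsupport _), one_smul]
  rw [hsum, map_sum]
  refine sum_mem fun i hi ↦ ?_
  rw [map_smul]
  exact Submodule.smul_mem _ _
    (hgU i _ (hρ i ((ρ.mem_fintsupport_iff _ i).1 hi)) q rfl)

theorem range_phi_eq_gaugeInvariantQuotient (hι : IsSmoothEmbedding (𝓡 n) (𝓡 m) ∞ ι)
    (hclosed : IsClosed (Set.range ι)) (hP : ConstantRank n P ι) :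
    (phi P ι).range = gaugeInvariantQuotient P ι := by
  ext a
  constructor
  · rintro ⟨b, rfl⟩
    obtain ⟨f, rfl⟩ := Ideal.Quotient.mk_surjective b
    exact ⟨f, fun h hh ↦ f.2 h hh.2, rfl⟩
  · rintro ⟨f, hf, rfl⟩
    obtain ⟨f', hf', hff'⟩ := exists_firstClass_sub_mem_vanishingIdeal P hι hclosed hP hf
    exact ⟨Ideal.Quotient.mk _ ⟨f', hf'⟩, Ideal.Quotient.eq.2 hff'⟩

end Constraints

end PoissonReduction

end

theorem mainTheorem3 {m n : ℕ}
    {M : Type*} [TopologicalSpace M] [T2Space M] [SecondCountableTopology M]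
    [ChartedSpace (EuclideanSpace ℝ (Fin m)) M] [IsManifold (𝓡 m) ∞ M]
    (P : PoissonReduction.PoissonStructure m M)
    {N : Type*} [TopologicalSpace N]
    [ChartedSpace (EuclideanSpace ℝ (Fin n)) N] [IsManifold (𝓡 n) ∞ N]
    (ι : N → M) (hι : IsSmoothEmbedding (𝓡 n) (𝓡 m) ∞ ι) (hclosed : IsClosed (Set.range ι)) :
    (PoissonReduction.ConstantRank n P ι → PoissonReduction.SpannedByConstraints n P ι) ∧
    (PreconnectedSpace N →
      PoissonReduction.SpannedByConstraints n P ι → PoissonReduction.ConstantRank n P ι) ∧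
    (PoissonReduction.ConstantRank n P ι →
      (PoissonReduction.phi P ι).range = PoissonReduction.gaugeInvariantQuotient P ι) :=
  ⟨PoissonReduction.spannedByConstraints_of_constantRank P hι,
    fun _ ↦ PoissonReduction.constantRank_of_spannedByConstraints P hι,
    PoissonReduction.range_phi_eq_gaugeInvariantQuotient P hι hclosed⟩
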